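/- For sequences of reals write $x_n\searrow x$ if $(x_n)$ is strictly decreasing and converges to $x$. A function $f\colon\mathbb{R}^2\to\mathbb{R}$ is called *feebly continuous* at $(x,y)$ if there exist sequences $x_n\searrow x$ and $y_m\searrow y$ such that $\lim_{n\to\infty}\lim_{m\to\infty}f(x_n,y_m)=f(x,y)$, and *very feebly continuous* at $(x,y)$ if there exist a sequence $x_n\searrow x$ and, for each $n\in\mathbb{N}$, a sequence $y^{(n)}_m\searrow y$ (as $m\to\infty$) such that $\lim_{n\to\infty}\lim_{m\to\infty}f(x_n,y^{(n)}_m)=f(x,y)$; here every inner limit is required to exist in $\mathbb{R}$. Let $FC(f)$ and $VFC(f)$ denote the sets of points of $\mathbb{R}^2$ at which $f$ is feebly continuous and very feebly continuous, respectively. If $f\colon\mathbb{R}^2\to\mathbb{R}$ is a Borel function, then each of the sets $FC(f)$ and $VFC(f)$ is analytic (that is, empty or a continuous image of the Baire space $\mathbb{N}^{\mathbb{N}}$), is residual in $\mathbb{R}^2$ (that is, its complement is meager), and has full Lebesgue measure (that is, its complement is a Lebesgue null set). -/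

import Mathlib

open Filter Topology

/-- `x n ↘ a`: the sequence `x` is strictly decreasing and converges to `a`. -/
def StrictlyDecreasesTo (x : ℕ → ℝ) (a : ℝ) : Prop :=
  StrictAnti x ∧ Tendsto x atTop (𝓝 a)

/-- `lim_n lim_m u n m = l`: for every `n` the inner limit over `m` exists (as a real number `α n`),
and these inner limits converge to `l`. -/
def IteratedLimit (u : ℕ → ℕ → ℝ) (l : ℝ) : Prop :=
  ∃ α : ℕ → ℝ, (∀ n, Tendsto (fun m => u n m) atTop (𝓝 (α n))) ∧ Tendsto α atTop (𝓝 l)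

/-- `f` is feebly continuous at the point `z = (z.1, z.2)` of the plane. -/
def FeeblyContinuousAt (f : ℝ × ℝ → ℝ) (z : ℝ × ℝ) : Prop :=
  ∃ x y : ℕ → ℝ, StrictlyDecreasesTo x z.1 ∧ StrictlyDecreasesTo y z.2 ∧
    IteratedLimit (fun n m => f (x n, y m)) (f z)

/-- `f` is very feebly continuous at `z`: the second sequence may depend on `n`. -/
def VeryFeeblyContinuousAt (f : ℝ × ℝ → ℝ) (z : ℝ × ℝ) : Prop :=
  ∃ (x : ℕ → ℝ) (y : ℕ → ℕ → ℝ), StrictlyDecreasesTo x z.1 ∧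
    (∀ n, StrictlyDecreasesTo (y n) z.2) ∧
    IteratedLimit (fun n m => f (x n, y n m)) (f z)

/-- The set `FC(f)` of points of feeble continuity of `f`. -/
def FC (f : ℝ × ℝ → ℝ) : Set (ℝ × ℝ) := {z | FeeblyContinuousAt f z}

/-- The set `VFC(f)` of points of very feeble continuity of `f`. -/
def VFC (f : ℝ × ℝ → ℝ) : Set (ℝ × ℝ) := {z | VeryFeeblyContinuousAt f z}

/-! If `v k → 0`, then `f (z + v k) → f z` for generic `z`, since `f` is continuous along a residual
set, and, after passing to a subsequence, for almost every `z`, since translation is continuous in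
L¹. Take a horizontal and a vertical null sequence. Both notions of largeness are translation
invariant and countably complete, so for most `z` the vertical limits hold at all the horizontal
translates of `z` at once; `z` is then in `FC f`, with offsets independent of `z`
(`FC_mem_of_tendsto_add`). Analyticity: `FC f` and `VFC f` are projections of Borel sets of points
with witnesses. -/

section Continuity

variable {E : Type*}

/-- A Borel function into a second countable space is continuous along some residual set. -/
theorem Measurable.exists_mem_residual_tendsto [TopologicalSpace E]
    [MeasurableSpace E] [BorelSpace E] {F : Type*} [TopologicalSpace F]
    [SecondCountableTopology F] [MeasurableSpace F] [OpensMeasurableSpace F]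
    {f : E → F} (hf : Measurable f) :
    ∃ G ∈ residual E, ∀ z ∈ G, Tendsto f (𝓝 z ⊓ 𝓟 G) (𝓝 (f z)) := by
  have hopen : ∀ U : TopologicalSpace.countableBasis F,
      ∃ V : Set E, IsOpen V ∧ f ⁻¹' U =ᶠ[residual E] V := fun U =>
    (hf (TopologicalSpace.isOpen_of_mem_countableBasis U.2).measurableSet).residualEq_isOpen
  choose V hVo hV using hopen
  have hcount := (TopologicalSpace.countable_countableBasis F).to_subtype
  -- On this set the preimage of each basic open set is the trace of an open set.
  have hG : ∀ᶠ z in residual E, ∀ U : TopologicalSpace.countableBasis F,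
      (z ∈ f ⁻¹' U ↔ z ∈ V U) :=
    eventually_countable_forall.2 fun U => eventuallyEq_set.1 (hV U)
  refine ⟨_, hG, fun z hz => ?_⟩
  rw [(TopologicalSpace.isBasis_countableBasis F).nhds_hasBasis.tendsto_right_iff]
  rintro U ⟨hU, hzU⟩
  have hzV : V ⟨U, hU⟩ ∈ 𝓝 z := (hVo _).mem_nhds ((hz ⟨U, hU⟩).1 hzU)
  filter_upwards [mem_inf_of_left hzV, mem_inf_of_right (mem_principal_self _)] with w hw hwG
  exact (hwG ⟨U, hU⟩).2 hw

/-- Translations preserve the residual filter. -/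
theorem tendsto_add_right_residual [TopologicalSpace E] [AddGroup E] [ContinuousAdd E] (v : E) :
    Tendsto (· + v) (residual E) (residual E) :=
  tendsto_residual_of_isOpenMap (Homeomorph.addRight v).continuous
    (Homeomorph.addRight v).isOpenMap

/-- Along a null sequence of translations, a Borel function converges to itself on a residual
set. -/
theorem Measurable.eventually_residual_tendsto_add [TopologicalSpace E] [AddGroup E]
    [ContinuousAdd E] [MeasurableSpace E] [BorelSpace E] {F : Type*} [TopologicalSpace F]
    [SecondCountableTopology F] [MeasurableSpace F] [OpensMeasurableSpace F]
    {f : E → F} (hf : Measurable f) {v : ℕ → E} (hv : Tendsto v atTop (𝓝 0)) :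
    ∀ᶠ z in residual E, Tendsto (fun k => f (z + v k)) atTop (𝓝 (f z)) := by
  obtain ⟨G, hG, hfG⟩ := hf.exists_mem_residual_tendsto
  have htrans : ∀ᶠ z in residual E, ∀ k, z + v k ∈ G :=
    eventually_countable_forall.2 fun k => tendsto_add_right_residual (v k) hG
  filter_upwards [hG, htrans] with z hz hzk
  refine (hfG z hz).comp (tendsto_inf.2 ⟨?_, tendsto_principal.2 (Eventually.of_forall hzk)⟩)
  simpa using tendsto_const_nhds (x := z).add hv

open MeasureTheory in
/-- Along a subsequence of a null sequence of translations, an integrable function converges to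
itself almost everywhere. -/
theorem MeasureTheory.Integrable.exists_subseq_ae_tendsto_add [NormedAddCommGroup E]
    [NormedSpace ℝ E] [FiniteDimensional ℝ E] [MeasurableSpace E] [BorelSpace E]
    {μ : Measure E} [μ.IsAddHaarMeasure] {F : Type*} [NormedAddCommGroup F]
    {g : E → F} (hg : Integrable g μ) {v : ℕ → E} (hv : Tendsto v atTop (𝓝 0)) :
    ∃ φ : ℕ → ℕ, StrictMono φ ∧
      ∀ᵐ z ∂μ, Tendsto (fun k => g (z + v (φ k))) atTop (𝓝 (g z)) := by
  have hg1 : MemLp g 1 μ := memLp_one_iff_integrable.2 hg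
  let T : E → C(E, E) := fun w => ⟨fun z => z + w, by fun_prop⟩
  have hTm : ∀ w, MeasurePreserving (T w) μ μ := fun w => measurePreserving_add_right μ w
  have hTc : Continuous T :=
    ContinuousMap.continuous_of_continuous_uncurry _
      (show Continuous fun p : E × E => p.2 + p.1 by fun_prop)
  -- L¹ convergence of the translates gives convergence in measure, hence almost everywhere along a
  -- subsequence.
  have hlim := (tendsto_const_nhds (x := hg1.toLp g)).compMeasurePreservingLp
    ((hTc.tendsto 0).comp hv) (fun k => hTm (v k)) (hTm 0) ENNReal.one_ne_top
  obtain ⟨φ, hφ, hae⟩ := (tendstoInMeasure_of_tendsto_Lp hlim).exists_seq_tendsto_ae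
  refine ⟨φ, hφ, ?_⟩
  simp only [Function.comp_apply, Lp.toLp_compMeasurePreserving] at hae
  have hk : ∀ᵐ z ∂μ, ∀ k, ((hg1.comp_measurePreserving (hTm (v (φ k)))).toLp _ : E → F) z
      = g (z + v (φ k)) :=
    ae_all_iff.2 fun k => (hg1.comp_measurePreserving (hTm (v (φ k)))).coeFn_toLp
  filter_upwards [hae, hk, (hg1.comp_measurePreserving (hTm 0)).coeFn_toLp] with z hz hzk hz0
  simp only [hzk, hz0] at hz
  simpa [T] using hz

open MeasureTheory in
/-- Along a subsequence of a null sequence of translations, a measurable function converges to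
itself almost everywhere. -/
theorem Measurable.exists_subseq_ae_tendsto_add [NormedAddCommGroup E]
    [NormedSpace ℝ E] [FiniteDimensional ℝ E] [MeasurableSpace E] [BorelSpace E]
    (μ : Measure E) [μ.IsAddHaarMeasure]
    {f : E → ℝ} (hf : Measurable f) {v : ℕ → E} (hv : Tendsto v atTop (𝓝 0)) :
    ∃ φ : ℕ → ℕ, StrictMono φ ∧
      ∀ᵐ z ∂μ, Tendsto (fun k => f (z + v (φ k))) atTop (𝓝 (f z)) := by
  -- An exponent above the dimension makes the weight `w` integrable; `arctan` makes `f` bounded, so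
  -- the product is integrable.
  let r : ℝ := Module.finrank ℝ E + 1
  let w : E → ℝ := fun z => (1 + ‖z‖) ^ (-r)
  have hwpos : ∀ z, 0 < w z := fun z => Real.rpow_pos_of_pos (by positivity) _
  have hwc : Continuous w :=
    (continuous_const.add continuous_norm).rpow_const fun z =>
      Or.inl (add_pos_of_pos_of_nonneg one_pos (norm_nonneg z)).ne'
  have hwi : Integrable w μ := integrable_one_add_norm (by simp [r])
  have hg : Integrable (fun z => Real.arctan (f z) * w z) μ := by
    refine hwi.bdd_mul (c := Real.pi / 2) hf.arctan.aestronglyMeasurable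
      (Eventually.of_forall fun z => ?_)
    rw [Real.norm_eq_abs, abs_le]
    exact ⟨(Real.neg_pi_div_two_lt_arctan _).le, (Real.arctan_lt_pi_div_two _).le⟩
  obtain ⟨φ, hφ, hae⟩ := hg.exists_subseq_ae_tendsto_add hv
  refine ⟨φ, hφ, hae.mono fun z hz => ?_⟩
  have hwz : Tendsto (fun k => w (z + v (φ k))) atTop (𝓝 (w z)) := by
    refine (hwc.tendsto z).comp ?_
    simpa using tendsto_const_nhds (x := z).add (hv.comp hφ.tendsto_atTop)
  -- The weight is continuous and positive, so it divides out; `tan` then undoes `arctan`.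
  have harctan := hz.div hwz (hwpos z).ne'
  simp only [Pi.div_def, mul_div_cancel_right₀ _ (hwpos _).ne'] at harctan
  simpa [Function.comp_def, Real.tan_arctan] using
    (Real.continuousAt_tan.2 (Real.cos_arctan_pos (f z)).ne').tendsto.comp harctan

end Continuity

theorem StrictlyDecreasesTo.add_one_div (a : ℝ) {φ : ℕ → ℕ} (hφ : StrictMono φ) :
    StrictlyDecreasesTo (fun n => a + 1 / ((φ n : ℝ) + 1)) a := by
  refine ⟨fun m n hmn => ?_, ?_⟩
  · have : (φ m : ℝ) < φ n := by exact_mod_cast hφ hmn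
    show a + 1 / ((φ n : ℝ) + 1) < a + 1 / ((φ m : ℝ) + 1)
    gcongr
  · simpa [Function.comp_def] using tendsto_const_nhds (x := a).add
      (tendsto_one_div_add_atTop_nhds_zero_nat.comp hφ.tendsto_atTop)

/-- `FC f` belongs to every translation invariant countably complete filter along which `f` is
the limit of its translates by a subsequence of any given null sequence. -/
theorem FC_mem_of_tendsto_add {f : ℝ × ℝ → ℝ} {L : Filter (ℝ × ℝ)} [CountableInterFilter L]
    (hL : ∀ v, Tendsto (· + v) L L)
    (hf : ∀ v : ℕ → ℝ × ℝ, Tendsto v atTop (𝓝 0) → ∃ φ : ℕ → ℕ, StrictMono φ ∧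
      ∀ᶠ z in L, Tendsto (fun k => f (z + v (φ k))) atTop (𝓝 (f z))) :
    FC f ∈ L := by
  have hnull := tendsto_one_div_add_atTop_nhds_zero_nat (𝕜 := ℝ)
  obtain ⟨φ, hφ, hφL⟩ := hf (fun n => (1 / ((n : ℝ) + 1), 0)) (hnull.prodMk_nhds tendsto_const_nhds)
  obtain ⟨ψ, hψ, hψL⟩ := hf (fun n => (0, 1 / ((n : ℝ) + 1))) (tendsto_const_nhds.prodMk_nhds hnull)
  have htrans : ∀ᶠ z in L, ∀ n, Tendsto
      (fun k => f (z + (1 / ((φ n : ℝ) + 1), 0) + (0, 1 / ((ψ k : ℝ) + 1)))) atTop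
      (𝓝 (f (z + (1 / ((φ n : ℝ) + 1), 0)))) :=
    eventually_countable_forall.2 fun n => (hL _).eventually hψL
  filter_upwards [hφL, htrans] with z hz hzn
  refine ⟨_, _, .add_one_div z.1 hφ, .add_one_div z.2 hψ, _, fun n => ?_, hz⟩
  simpa only [Prod.add_def, add_zero] using hzn n

theorem FC_subset_VFC (f : ℝ × ℝ → ℝ) : FC f ⊆ VFC f :=
  fun _ ⟨x, y, hx, hy, h⟩ => ⟨x, fun _ => y, hx, fun _ => hy, h⟩

section Analytic

variable {P : Type*} [MeasurableSpace P]

theorem measurableSet_strictlyDecreasesTo {x : P → ℕ → ℝ} {a : P → ℝ} (hx : Measurable x)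
    (ha : Measurable a) : MeasurableSet {p | StrictlyDecreasesTo (x p) (a p)} := by
  have hx' : ∀ n, Measurable fun p => x p n := fun n => (measurable_pi_apply n).comp hx
  have hanti : MeasurableSet {p | StrictAnti (x p)} := by
    simp only [StrictAnti, Set.ofPred_forall]
    exact .iInter fun m => .iInter fun n => .iInter fun _ => measurableSet_lt (hx' n) (hx' m)
  exact hanti.inter (MeasureTheory.measurableSet_tendsto_fun hx' ha)

/-- Carrying the inner limits `α` as a coordinate leaves only countable quantifiers; the existential
over `α` is left to the projection. -/
theorem measurableSet_iteratedLimit_graph {u : P → ℕ → ℕ → ℝ} {α : P → ℕ → ℝ} {l : P → ℝ}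
    (hu : ∀ n m, Measurable fun p => u p n m) (hα : Measurable α) (hl : Measurable l) :
    MeasurableSet {p | (∀ n, Tendsto (fun m => u p n m) atTop (𝓝 (α p n))) ∧
      Tendsto (α p) atTop (𝓝 (l p))} := by
  have hα' : ∀ n, Measurable fun p => α p n := fun n => (measurable_pi_apply n).comp hα
  have hinner : MeasurableSet {p | ∀ n, Tendsto (fun m => u p n m) atTop (𝓝 (α p n))} := by
    simp only [Set.ofPred_forall]
    exact .iInter fun n => MeasureTheory.measurableSet_tendsto_fun (hu n) (hα' n)
  exact hinner.inter (MeasureTheory.measurableSet_tendsto_fun hα' hl)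

theorem analyticSet_FC {f : ℝ × ℝ → ℝ} (hf : Measurable f) : MeasureTheory.AnalyticSet (FC f) := by
  let S : Set ((ℝ × ℝ) × (ℕ → ℝ) × (ℕ → ℝ) × (ℕ → ℝ)) :=
    {p | StrictlyDecreasesTo p.2.1 p.1.1} ∩ ({p | StrictlyDecreasesTo p.2.2.1 p.1.2} ∩
      {p | (∀ n, Tendsto (fun m => f (p.2.1 n, p.2.2.1 m)) atTop (𝓝 (p.2.2.2 n))) ∧
        Tendsto p.2.2.2 atTop (𝓝 (f p.1))})
  have hS : MeasurableSet S :=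
    (measurableSet_strictlyDecreasesTo (by fun_prop) (by fun_prop)).inter
      ((measurableSet_strictlyDecreasesTo (by fun_prop) (by fun_prop)).inter
        (measurableSet_iteratedLimit_graph (fun n m => hf.comp (by fun_prop)) (by fun_prop)
          (by fun_prop)))
  have himage : FC f = Prod.fst '' S := by
    ext z
    constructor
    · rintro ⟨x, y, hx, hy, α, h⟩
      exact ⟨(z, x, y, α), ⟨hx, hy, h⟩, rfl⟩
    · rintro ⟨⟨_, x, y, α⟩, ⟨hx, hy, h⟩, rfl⟩
      exact ⟨x, y, hx, hy, α, h⟩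
  rw [himage]
  exact hS.analyticSet_image measurable_fst

theorem analyticSet_VFC {f : ℝ × ℝ → ℝ} (hf : Measurable f) :
    MeasureTheory.AnalyticSet (VFC f) := by
  -- The double sequence ranges over a countable product of lines, so the ambient space is still
  -- Polish.
  let S : Set ((ℝ × ℝ) × (ℕ → ℝ) × (ℕ → ℕ → ℝ) × (ℕ → ℝ)) :=
    {p | StrictlyDecreasesTo p.2.1 p.1.1} ∩ ((⋂ n, {p | StrictlyDecreasesTo (p.2.2.1 n) p.1.2}) ∩
      {p | (∀ n, Tendsto (fun m => f (p.2.1 n, p.2.2.1 n m)) atTop (𝓝 (p.2.2.2 n))) ∧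
        Tendsto p.2.2.2 atTop (𝓝 (f p.1))})
  have hS : MeasurableSet S :=
    (measurableSet_strictlyDecreasesTo (by fun_prop) (by fun_prop)).inter
      ((MeasurableSet.iInter fun n =>
        measurableSet_strictlyDecreasesTo (by fun_prop) (by fun_prop)).inter
        (measurableSet_iteratedLimit_graph (fun n m => hf.comp (by fun_prop)) (by fun_prop)
          (by fun_prop)))
  have himage : VFC f = Prod.fst '' S := by
    ext z
    constructor
    · rintro ⟨x, y, hx, hy, α, h⟩
      exact ⟨(z, x, y, α), ⟨hx, Set.mem_iInter.2 hy, h⟩, rfl⟩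
    · rintro ⟨⟨_, x, y, α⟩, ⟨hx, hy, h⟩, rfl⟩
      exact ⟨x, y, hx, Set.mem_iInter.1 hy, α, h⟩
  rw [himage]
  exact hS.analyticSet_image measurable_fst

end Analytic

theorem corollary2p4 (f : ℝ × ℝ → ℝ) (hf : Measurable f) :
    (MeasureTheory.AnalyticSet (FC f) ∧ FC f ∈ residual (ℝ × ℝ) ∧
      MeasureTheory.volume (FC f)ᶜ = 0) ∧
    (MeasureTheory.AnalyticSet (VFC f) ∧ VFC f ∈ residual (ℝ × ℝ) ∧
      MeasureTheory.volume (VFC f)ᶜ = 0) := by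
  have hres : FC f ∈ residual (ℝ × ℝ) :=
    FC_mem_of_tendsto_add tendsto_add_right_residual fun v hv =>
      ⟨id, strictMono_id, hf.eventually_residual_tendsto_add hv⟩
  have hae : FC f ∈ MeasureTheory.ae (MeasureTheory.volume : MeasureTheory.Measure (ℝ × ℝ)) :=
    FC_mem_of_tendsto_add
      (fun v => (MeasureTheory.measurePreserving_add_right _ v).quasiMeasurePreserving.tendsto_ae)
      fun v hv => hf.exists_subseq_ae_tendsto_add _ hv
  exact ⟨⟨analyticSet_FC hf, hres, hae⟩, analyticSet_VFC hf,
    mem_of_superset hres (FC_subset_VFC f), mem_of_superset hae (FC_subset_VFC f)⟩
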